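/- Let $M$ be a time-oriented Lorentzian manifold (smooth, signature $(-,+,\dots,+)$) with no closed timelike curves. For $p,r\in M$ write $p\ll r$ if there is a (piecewise smooth) future-directed timelike curve from $p$ to $r$, and let the diamond $D(p,r)$ be $\{q : p\ll q\ll r\}$. Call a subset of $M$ bounded if it is contained in a finite union of diamonds. For bounded sets (regions) $A,B$ let $A\subseteq B$ be inclusion, and let $A\prec B$ mean that $a\ll b$ for all $a\in A$, $b\in B$. In any set of regions with relations $\subseteq$ and $\prec$, a region is called empty if it is contained in every region, and two regions are disjoint if only an empty region is contained in both. A causal path from $A$ to $C$ is a finite sequence $A_1,\dots,A_m$ ($m\ge 0$) of non-empty regions with $A\prec A_1\prec\cdots\prec A_m\prec C$ (for $m=0$: $A\prec C$). A path $C_1\prec\cdots\prec C_k$ refines $A_1\prec\cdots\prec A_m$ if both $\{A_i\}$ and $\{C_j\}$ are sets of pairwise disjoint regions and every $A_i$ contains some $C_j$. If $A\prec C$, a region $B$ is complete for $A\prec C$ if $A\prec B\prec C$ and every causal path from $A$ to $C$ can be refined to a causal path from $A$ to $C$ one of whose members is contained in $B$. Then the bounded regions of $M$, with $\subseteq$ and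 $\prec$, form a causal site; that is: 1. $\subseteq$ is a partial order. 2. There is an empty region. 3. Any two regions $A,B$ have a union (least upper bound) $A\cup B$. 4. $\prec$ is transitive and irreflexive on non-empty regions. 5. If $A\subseteq B$ and $B\prec C$, then $A\prec C$. 6. If $A\subseteq B$ and $C\prec B$, then $C\prec A$. 7. If $A\prec C$ and $B\prec C$, then $A\cup B\prec C$. 8. For all regions $A,B$ there is a largest region $B_A$ (the cutting) among those contained in $B$ and preceding $A$. 9. If $A,C$ are non-empty, $A\prec C$, and there is a non-empty region $D$ with $A\prec D\prec C$, then there is a region $B$ complete for $A\prec C$. Moreover, the cutting is $B_A=\{p\in B : \{p\}\prec A\}$, which is bounded; and, whenever $A,C$ are non-empty regions with $A\prec C$ and $A\prec D\prec C$ for some non-empty region $D$, the set $\{p\in M : A\prec\{p\}\prec C\}$ is bounded and is complete for $A\prec C$. -/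

import Mathlib

open scoped Manifold ContDiff

/-! ## Causal sites -/

namespace CausalSite

variable {R : Type*} (sub prec : R → R → Prop)

/-- `A` is an empty region: a minimum element for inclusion. -/
def IsEmptyRegion (A : R) : Prop := ∀ B, sub A B

/-- `U` is the union (least upper bound) of `A` and `B`. -/
structure IsUnion (A B U : R) : Prop where
  left : sub A U
  right : sub B U
  least : ∀ C, sub A C → sub B C → sub U C

/-- `K` is the cutting of `A` by `B` (usually written `B_A`): the largest region contained in `B`
that precedes `A`. -/
structure IsCutting (A B K : R) : Prop where
  prec_left : prec K A
  sub_right : sub K B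
  greatest : ∀ D, prec D A → sub D B → sub D K

/-- Two regions are disjoint if only the empty region is contained in both. -/
def DisjointRegions (A B : R) : Prop := ∀ D, sub D A → sub D B → IsEmptyRegion sub D

/-- A set of regions is disjoint if its members are pairwise disjoint. -/
def DisjointSet (S : Set R) : Prop := S.Pairwise (DisjointRegions sub)

/-- The set of disjoint regions `T` is a refinement of the set of disjoint regions `S`: every
region of `S` contains some region of `T`. -/
structure IsRefinement (S T : Set R) : Prop where
  disjoint_left : DisjointSet sub S
  disjoint_right : DisjointSet sub T
  contains : ∀ A ∈ S, ∃ B ∈ T, sub B A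

/-- The list `P = [A₁, …, Aₘ]` of non-empty regions is a causal path from `A` to `B`:
`A ≺ A₁ ≺ ⋯ ≺ Aₘ ≺ B`. The case `m = 0` is allowed and then means `A ≺ B`. -/
structure IsCausalPath (A B : R) (P : List R) : Prop where
  nonempty : ∀ X ∈ P, ¬ IsEmptyRegion sub X
  chain : List.IsChain prec (A :: (P ++ [B]))

/-- `B` is complete for the causal pair `A ≺ C`: `A ≺ B ≺ C`, and every causal path from `A` to
`C` can be refined to a causal path from `A` to `C` one of whose members is contained in `B`. -/
structure IsComplete (A C B : R) : Prop where
  pair : prec A C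
  left : prec A B
  right : prec B C
  refine_path : ∀ P, IsCausalPath sub prec A C P →
    ∃ Q, IsCausalPath sub prec A C Q ∧ IsRefinement sub {X | X ∈ P} {X | X ∈ Q} ∧
      ∃ X ∈ Q, sub X B

/-- The regions `R` with the relations `sub` (`⊆`) and `prec` (`≺`) form a causal site. -/
structure IsCausalSite : Prop where
  sub_trans : ∀ A B C, sub A B → sub B C → sub A C
  sub_refl : ∀ A, sub A A
  sub_antisymm : ∀ A B, sub A B → sub B A → A = B
  exists_empty : ∃ φ, IsEmptyRegion sub φ
  exists_union : ∀ A B, ∃ U, IsUnion sub A B U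
  prec_trans : ∀ A B C, ¬ IsEmptyRegion sub A → ¬ IsEmptyRegion sub B → ¬ IsEmptyRegion sub C →
    prec A B → prec B C → prec A C
  prec_irrefl : ∀ A, ¬ IsEmptyRegion sub A → ¬ prec A A
  prec_of_sub_left : ∀ A B C, sub A B → prec B C → prec A C
  prec_of_sub_right : ∀ A B C, sub A B → prec C B → prec C A
  union_prec : ∀ A B C U, IsUnion sub A B U → prec A C → prec B C → prec U C
  exists_cutting : ∀ A B, ∃ K, IsCutting sub prec A B K
  exists_complete : ∀ A C, ¬ IsEmptyRegion sub A → ¬ IsEmptyRegion sub C → prec A C →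
    (∃ D, ¬ IsEmptyRegion sub D ∧ prec A D ∧ prec D C) → ∃ B, IsComplete sub prec A C B

end CausalSite

/-! ## Lorentzian manifolds and their causal structure -/

/-- A smooth Lorentzian metric, of signature `(-, +, …, +)`, on a smooth `n`-manifold. -/
structure LorentzianMetric (n : ℕ) (M : Type*) [TopologicalSpace M]
    [ChartedSpace (EuclideanSpace ℝ (Fin n)) M] [IsManifold (𝓡 n) ∞ M] where
  /-- The bilinear form on each tangent space. -/
  form (p : M) : TangentSpace (𝓡 n) p →L[ℝ] TangentSpace (𝓡 n) p →L[ℝ] ℝ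
  symm (p : M) (v w : TangentSpace (𝓡 n) p) : form p v w = form p w v
  /-- There is a timelike vector on whose orthogonal complement the form is positive definite. -/
  signature (p : M) : ∃ v : TangentSpace (𝓡 n) p, form p v v < 0 ∧
    ∀ w : TangentSpace (𝓡 n) p, form p v w = 0 → w ≠ 0 → 0 < form p w w
  contMDiff : ContMDiff (𝓡 n)
    ((𝓡 n).prod 𝓘(ℝ, EuclideanSpace ℝ (Fin n) →L[ℝ] EuclideanSpace ℝ (Fin n) →L[ℝ] ℝ)) ∞
    (fun p : M => Bundle.TotalSpace.mk'
      (EuclideanSpace ℝ (Fin n) →L[ℝ] EuclideanSpace ℝ (Fin n) →L[ℝ] ℝ)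
      (E := fun p : M => TangentSpace (𝓡 n) p →L[ℝ] TangentSpace (𝓡 n) p →L[ℝ] ℝ) p (form p))

/-- A time orientation of a Lorentzian manifold: a choice, at each point, of one of the two cones
of timelike vectors (the future cone), which near every point is the cone containing a continuous
timelike vector field `X`. -/
structure TimeOrientation {n : ℕ} {M : Type*} [TopologicalSpace M]
    [ChartedSpace (EuclideanSpace ℝ (Fin n)) M] [IsManifold (𝓡 n) ∞ M]
    (g : LorentzianMetric n M) where
  /-- The cone of future-directed timelike vectors at a point. -/
  future (p : M) : Set (TangentSpace (𝓡 n) p)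
  locally_vectorField (p : M) : ∃ U ∈ nhds p, ∃ X : (q : M) → TangentSpace (𝓡 n) q,
    ContinuousOn (fun q => (⟨q, X q⟩ : TangentBundle (𝓡 n) M)) U ∧
    ∀ q ∈ U, g.form q (X q) (X q) < 0 ∧
      future q = {v | g.form q v v < 0 ∧ g.form q (X q) v < 0}

namespace TimeOrientation

variable {n : ℕ} {M : Type*} [TopologicalSpace M]
  [ChartedSpace (EuclideanSpace ℝ (Fin n)) M] [IsManifold (𝓡 n) ∞ M]
  {g : LorentzianMetric n M} (τ : TimeOrientation g)

/-- The velocity at time `t` of a curve parametrised by `[a, b]` (one-sided at `a` and `b`). -/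
noncomputable def velocity (γ : ℝ → M) (a b t : ℝ) : TangentSpace (𝓡 n) (γ t) :=
  mfderivWithin 𝓘(ℝ, ℝ) (𝓡 n) γ (Set.Icc a b) t (1 : ℝ)

/-- `γ`, restricted to `[a, b]`, is a piecewise smooth future-directed timelike curve: for some
subdivision `a = t₀ < t₁ < ⋯ < tₖ = b` with `k ≥ 1`, it is smooth on each closed interval
`[tᵢ, tᵢ₊₁]`, with future-directed timelike velocity throughout that interval. -/
def IsFutureTimelikeCurve (γ : ℝ → M) (a b : ℝ) : Prop :=
  ∃ (k : ℕ) (t : ℕ → ℝ), 0 < k ∧ t 0 = a ∧ t k = b ∧ ∀ i < k, t i < t (i + 1) ∧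
    ContMDiffOn 𝓘(ℝ, ℝ) (𝓡 n) ∞ γ (Set.Icc (t i) (t (i + 1))) ∧
    ∀ s ∈ Set.Icc (t i) (t (i + 1)), velocity γ (t i) (t (i + 1)) s ∈ τ.future (γ s)

/-- The same with past-directed timelike velocities. -/
def IsPastTimelikeCurve (γ : ℝ → M) (a b : ℝ) : Prop :=
  ∃ (k : ℕ) (t : ℕ → ℝ), 0 < k ∧ t 0 = a ∧ t k = b ∧ ∀ i < k, t i < t (i + 1) ∧
    ContMDiffOn 𝓘(ℝ, ℝ) (𝓡 n) ∞ γ (Set.Icc (t i) (t (i + 1))) ∧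
    ∀ s ∈ Set.Icc (t i) (t (i + 1)), -velocity γ (t i) (t (i + 1)) s ∈ τ.future (γ s)

/-- There are no closed timelike curves. -/
def NoClosedTimelikeCurves : Prop :=
  ¬ ∃ (γ : ℝ → M) (a b : ℝ),
    (τ.IsFutureTimelikeCurve γ a b ∨ τ.IsPastTimelikeCurve γ a b) ∧ γ a = γ b

/-- The chronological relation `p ≪ r`: there is a future-directed timelike curve from `p` to
`r`. -/
def Chron (p r : M) : Prop :=
  ∃ (γ : ℝ → M) (a b : ℝ), τ.IsFutureTimelikeCurve γ a b ∧ γ a = p ∧ γ b = r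

/-- The diamond `D(p, r)`. -/
def diamond (p r : M) : Set M := {q | τ.Chron p q ∧ τ.Chron q r}

/-- A set is bounded if it is contained in a finite union of diamonds. -/
def IsBoundedRegion (A : Set M) : Prop :=
  ∃ F : Set (M × M), F.Finite ∧ A ⊆ ⋃ x ∈ F, τ.diamond x.1 x.2

/-- Every point of `A` chronologically precedes every point of `B`. -/
def Precedes (A B : Set M) : Prop := ∀ a ∈ A, ∀ b ∈ B, τ.Chron a b

/-- The bounded regions. -/
def Region : Type _ := {A : Set M // τ.IsBoundedRegion A}

/-- Inclusion of bounded regions. -/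
def regionSub (A B : τ.Region) : Prop := A.1 ⊆ B.1

/-- Precedence of bounded regions. -/
def regionPrec (A B : τ.Region) : Prop := τ.Precedes A.1 B.1

end TimeOrientation

/-!
The chronological relation `≪` is transitive, because timelike curves are only piecewise smooth and
so may be concatenated (`TimeOrientation.Chron.trans`); it is irreflexive because there are no
closed timelike curves. The axioms of a causal site are formal consequences of these two facts.
A region is empty exactly when its underlying set is `∅`, unions are unions of sets, and the cutting
is bounded as a subset of a bounded set.

For completeness, put `B = {p | A ≺ {p} ≺ C}`. It is contained in the diamond `D(a, c)` for any
`a ∈ A` and `c ∈ C`, hence bounded. By transitivity every member of a causal path from `A` to `C`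
precedes `C` and is preceded by `A`, so it is contained in `B`; a non-empty path is thus its own
refinement, its members being disjoint since a common point `p` of two of them would satisfy
`p ≪ p`. The empty path is refined by `[D]`, where `D` is the given non-empty region between `A`
and `C`.
-/

namespace TimeOrientation

variable {n : ℕ} {M : Type*} [TopologicalSpace M]
  [ChartedSpace (EuclideanSpace ℝ (Fin n)) M] [IsManifold (𝓡 n) ∞ M]
  {g : LorentzianMetric n M} {τ : TimeOrientation g}

/-! ### Concatenation of timelike curves -/

variable (τ) in
/-- `γ`, restricted to `[a, b]` with `a < b`, is a smooth future-directed timelike curve: one smooth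
piece of a curve in the sense of `IsFutureTimelikeCurve`. -/
def IsSmoothFutureTimelikeCurve (γ : ℝ → M) (a b : ℝ) : Prop :=
  a < b ∧ ContMDiffOn 𝓘(ℝ, ℝ) (𝓡 n) ∞ γ (Set.Icc a b) ∧
    ∀ s ∈ Set.Icc a b, velocity γ a b s ∈ τ.future (γ s)

/-- Membership in the future cone transfers along an equality of base points; the vector keeps its
coordinates, all tangent spaces being the same type by definition. -/
theorem mem_future_of_eq {p q : M} (h : p = q) (v : EuclideanSpace ℝ (Fin n))
    (hv : (show TangentSpace (𝓡 n) p from v) ∈ τ.future p) :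
    (show TangentSpace (𝓡 n) q from v) ∈ τ.future q := by
  subst h
  exact hv

theorem IsSmoothFutureTimelikeCurve.congr {γ γ' : ℝ → M} {a b : ℝ}
    (h : τ.IsSmoothFutureTimelikeCurve γ a b) (he : Set.EqOn γ' γ (Set.Icc a b)) :
    τ.IsSmoothFutureTimelikeCurve γ' a b := by
  obtain ⟨hab, hs, hv⟩ := h
  refine ⟨hab, hs.congr he, fun s hs' => ?_⟩
  have hvel : velocity γ' a b s = (velocity γ a b s : EuclideanSpace ℝ (Fin n)) := by
    unfold velocity
    rw [mfderivWithin_congr he (he hs')]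
    rfl
  rw [hvel]
  exact mem_future_of_eq (he hs').symm _ (hv s hs')

theorem IsSmoothFutureTimelikeCurve.comp_add_const {γ : ℝ → M} {a b : ℝ}
    (h : τ.IsSmoothFutureTimelikeCurve γ a b) (e : ℝ) :
    τ.IsSmoothFutureTimelikeCurve (fun t => γ (t + e)) (a - e) (b - e) := by
  obtain ⟨hab, hs, hv⟩ := h
  have hmaps : Set.MapsTo (fun t : ℝ => t + e) (Set.Icc (a - e) (b - e)) (Set.Icc a b) :=
    fun t ht => ⟨by linarith [ht.1], by linarith [ht.2]⟩
  have htr : ContMDiff 𝓘(ℝ, ℝ) 𝓘(ℝ, ℝ) ∞ (fun t : ℝ => t + e) :=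
    (contDiff_id.add contDiff_const).contMDiff
  refine ⟨by linarith, hs.comp htr.contMDiffOn hmaps, fun s hs' => ?_⟩
  have hu : UniqueMDiffWithinAt 𝓘(ℝ, ℝ) (Set.Icc (a - e) (b - e)) s :=
    (uniqueDiffOn_Icc (by linarith) s hs').uniqueMDiffWithinAt
  have hvel : velocity (fun t => γ (t + e)) (a - e) (b - e) s =
      (velocity γ a b (s + e) : EuclideanSpace ℝ (Fin n)) := by
    have hγ : HasMFDerivWithinAt 𝓘(ℝ, ℝ) (𝓡 n) γ (Set.Icc a b) (s + e)
        (mfderivWithin 𝓘(ℝ, ℝ) (𝓡 n) γ (Set.Icc a b) (s + e)) :=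
      ((hs (s + e) (hmaps hs')).mdifferentiableWithinAt (by simp)).hasMFDerivWithinAt
    have hadd : HasMFDerivWithinAt 𝓘(ℝ, ℝ) 𝓘(ℝ, ℝ) (fun t : ℝ => t + e)
        (Set.Icc (a - e) (b - e)) s (ContinuousLinearMap.id ℝ ℝ) :=
      ((hasFDerivAt_id s).add_const e).hasFDerivWithinAt.hasMFDerivWithinAt
    have hcomp := (HasMFDerivWithinAt.comp (u := Set.Icc a b) s hγ hadd hmaps).mfderivWithin hu
    unfold velocity
    exact DFunLike.congr_fun hcomp (1 : ℝ)
  rw [hvel]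
  exact hv (s + e) (hmaps hs')

theorem Chron.trans {p q r : M} (hpq : τ.Chron p q) (hqr : τ.Chron q r) : τ.Chron p r := by
  obtain ⟨γ, a, b, ⟨k, t, hk, rfl, rfl, ht⟩, rfl, rfl⟩ := hpq
  obtain ⟨δ, c, d, ⟨l, u, hl, rfl, rfl, hu⟩, hδ, rfl⟩ := hqr
  have hγs (i : ℕ) (hi : i < k) : τ.IsSmoothFutureTimelikeCurve γ (t i) (t (i + 1)) := ht i hi
  have hδs (i : ℕ) (hi : i < l) : τ.IsSmoothFutureTimelikeCurve δ (u i) (u (i + 1)) := hu i hi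
  have ht_le (i : ℕ) (hi : i ≤ k) : t i ≤ t k :=
    Nat.decreasingInduction' (P := fun i => t i ≤ t k)
      (fun j hj _ h => (ht j hj).1.le.trans h) hi le_rfl
  have hu_le (i : ℕ) (hi : i ≤ l) : u 0 ≤ u i := by
    induction i with
    | zero => exact le_rfl
    | succ j ih => exact (ih (by omega)).trans (hu j (by omega)).1.le
  -- The second curve is translated so as to start at the parameter value where the first one ends.
  set e := u 0 - t k with he
  let η : ℝ → M := fun s => if s ≤ t k then γ s else δ (s + e)
  let v : ℕ → ℝ := fun i => if i ≤ k then t i else u (i - k) - e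
  have hv_left (i : ℕ) (hi : i ≤ k) : v i = t i := if_pos hi
  have hv_right (i : ℕ) : v (k + i) = u i - e := by
    rcases Nat.eq_zero_or_pos i with rfl | hi
    · simp [v, he]
    · simp [v, hi.ne']
  have hη_left (s : ℝ) (hs : s ≤ t k) : η s = γ s := if_pos hs
  have hη_right (s : ℝ) (hs : t k ≤ s) : η s = δ (s + e) := by
    rcases hs.eq_or_lt with rfl | hs
    · rw [hη_left _ le_rfl, ← hδ, he, add_sub_cancel]
    · exact if_neg hs.not_ge
  refine ⟨η, t 0, u l - e, ⟨k + l, v, by omega, hv_left 0 (by omega), hv_right l, ?_⟩,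
    hη_left _ (ht_le 0 (by omega)), ?_⟩
  · intro i hi
    change τ.IsSmoothFutureTimelikeCurve η (v i) (v (i + 1))
    rcases lt_or_ge i k with hik | hik
    · rw [hv_left i hik.le, hv_left (i + 1) hik]
      exact (hγs i hik).congr fun s hs => hη_left s (hs.2.trans (ht_le _ hik))
    · obtain ⟨j, rfl⟩ := Nat.exists_eq_add_of_le hik
      rw [hv_right j, add_assoc, hv_right (j + 1)]
      refine ((hδs j (by omega)).comp_add_const e).congr fun s hs => hη_right s ?_
      linarith [hs.1, hu_le j (by omega)]
  · rw [hη_right _ (by linarith [hu_le l le_rfl]), sub_add_cancel]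

theorem NoClosedTimelikeCurves.not_chron_self (hM : τ.NoClosedTimelikeCurves) (p : M) :
    ¬ τ.Chron p p := by
  rintro ⟨γ, a, b, hγ, ha, hb⟩
  exact hM ⟨γ, a, b, Or.inl hγ, ha.trans hb.symm⟩

/-! ### Bounded regions -/

theorem IsBoundedRegion.mono {A B : Set M} (hB : τ.IsBoundedRegion B) (h : A ⊆ B) :
    τ.IsBoundedRegion A := by
  obtain ⟨F, hF, hBF⟩ := hB
  exact ⟨F, hF, h.trans hBF⟩

theorem isBoundedRegion_empty : τ.IsBoundedRegion ∅ :=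
  ⟨∅, Set.finite_empty, Set.empty_subset _⟩

theorem isBoundedRegion_diamond (p r : M) : τ.IsBoundedRegion (τ.diamond p r) :=
  ⟨{(p, r)}, Set.finite_singleton _, by simp⟩

theorem IsBoundedRegion.union {A B : Set M} (hA : τ.IsBoundedRegion A)
    (hB : τ.IsBoundedRegion B) : τ.IsBoundedRegion (A ∪ B) := by
  obtain ⟨F, hF, hAF⟩ := hA
  obtain ⟨G, hG, hBG⟩ := hB
  refine ⟨F ∪ G, hF.union hG, ?_⟩
  rw [Set.biUnion_union]
  exact Set.union_subset_union hAF hBG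

theorem isEmptyRegion_iff {A : τ.Region} :
    CausalSite.IsEmptyRegion τ.regionSub A ↔ A.1 = ∅ := by
  refine ⟨fun h => Set.subset_empty_iff.1 (h ⟨∅, isBoundedRegion_empty⟩), fun h B => ?_⟩
  exact h.subset.trans (Set.empty_subset B.1)

theorem not_isEmptyRegion_iff {A : τ.Region} :
    ¬ CausalSite.IsEmptyRegion τ.regionSub A ↔ A.1.Nonempty := by
  rw [isEmptyRegion_iff, Set.nonempty_iff_ne_empty]

theorem Precedes.trans {A B C : Set M} (hB : B.Nonempty) (hAB : τ.Precedes A B)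
    (hBC : τ.Precedes B C) : τ.Precedes A C := by
  obtain ⟨b, hb⟩ := hB
  exact fun a ha c hc => (hAB a ha b hb).trans (hBC b hb c hc)

theorem isUnion_union (A B : τ.Region) :
    CausalSite.IsUnion τ.regionSub A B ⟨A.1 ∪ B.1, A.2.union B.2⟩ where
  left := Set.subset_union_left
  right := Set.subset_union_right
  least _ := Set.union_subset

theorem isBoundedRegion_cutting (A B : τ.Region) :
    τ.IsBoundedRegion {p | p ∈ B.1 ∧ τ.Precedes {p} A.1} :=
  B.2.mono fun _ hp => hp.1

theorem isCutting_cutting (A B : τ.Region) :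
    CausalSite.IsCutting τ.regionSub τ.regionPrec A B
      ⟨{p | p ∈ B.1 ∧ τ.Precedes {p} A.1}, isBoundedRegion_cutting A B⟩ where
  prec_left p hp := hp.2 p rfl
  sub_right _ hp := hp.1
  greatest D hDA hDB d hd := by
    refine ⟨hDB hd, ?_⟩
    rintro _ rfl
    exact hDA _ hd

/-! ### Causal paths and complete regions -/

/-- In a causal path from `A` to `C` the relation `≺`, given between neighbours, holds between any
two regions in order, because the intermediate regions are non-empty. -/
theorem pairwise_of_isCausalPath {A C : τ.Region} {P : List τ.Region}
    (hP : CausalSite.IsCausalPath τ.regionSub τ.regionPrec A C P) :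
    (A :: (P ++ [C])).Pairwise τ.regionPrec := by
  obtain ⟨hne, hchain⟩ := hP
  induction P generalizing A with
  | nil => simpa using hchain
  | cons X P ih =>
    rw [List.cons_append, List.isChain_cons_cons] at hchain
    have hXP := ih (fun Y hY => hne Y (List.mem_cons_of_mem X hY)) hchain.2
    have hX : X.1.Nonempty := not_isEmptyRegion_iff.1 (hne X List.mem_cons_self)
    refine List.pairwise_cons.2 ⟨fun Y hY => ?_, hXP⟩
    rcases List.mem_cons.1 hY with rfl | hY
    · exact hchain.1
    · exact Precedes.trans hX hchain.1 (List.rel_of_pairwise_cons hXP hY)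

/-- Without closed timelike curves, a region that precedes another is disjoint from it. -/
theorem NoClosedTimelikeCurves.disjointRegions (hM : τ.NoClosedTimelikeCurves) {A B : τ.Region}
    (h : τ.regionPrec A B) : CausalSite.DisjointRegions τ.regionSub A B := by
  intro D hDA hDB
  refine isEmptyRegion_iff.2 (Set.eq_empty_of_forall_notMem fun d hd => ?_)
  exact hM.not_chron_self d (h d (hDA hd) d (hDB hd))

theorem NoClosedTimelikeCurves.disjointSet_of_isCausalPath (hM : τ.NoClosedTimelikeCurves)
    {A C : τ.Region} {P : List τ.Region}
    (hP : CausalSite.IsCausalPath τ.regionSub τ.regionPrec A C P) :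
    CausalSite.DisjointSet τ.regionSub {X | X ∈ P} := by
  have hPP : P.Pairwise τ.regionPrec :=
    (List.pairwise_append.1 (List.pairwise_cons.1 (pairwise_of_isCausalPath hP)).2).1
  have hdis := hPP.imp fun h => hM.disjointRegions h
  have hsymm : Std.Symm (CausalSite.DisjointRegions τ.regionSub) :=
    ⟨fun _ _ h D hDX hDY => h D hDY hDX⟩
  exact fun X hX Y hY hXY => hdis.forall hX hY hXY

theorem isBoundedRegion_between {A C : Set M} (hA : A.Nonempty) (hC : C.Nonempty) :
    τ.IsBoundedRegion {p | τ.Precedes A {p} ∧ τ.Precedes {p} C} := by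
  obtain ⟨a, ha⟩ := hA
  obtain ⟨c, hc⟩ := hC
  exact (isBoundedRegion_diamond a c).mono fun p hp => ⟨hp.1 a ha p rfl, hp.2 p rfl c hc⟩

theorem NoClosedTimelikeCurves.isComplete_between (hM : τ.NoClosedTimelikeCurves)
    {A C D : τ.Region} (hA : A.1.Nonempty) (hC : C.1.Nonempty) (hD : D.1.Nonempty)
    (hAD : τ.regionPrec A D) (hDC : τ.regionPrec D C) :
    CausalSite.IsComplete τ.regionSub τ.regionPrec A C
      ⟨{p | τ.Precedes A.1 {p} ∧ τ.Precedes {p} C.1}, isBoundedRegion_between hA hC⟩ where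
  pair := Precedes.trans hD hAD hDC
  left a ha p hp := hp.1 a ha p rfl
  right p hp := hp.2 p rfl
  refine_path P hP := by
    have hsub (X : τ.Region) (hAX : τ.regionPrec A X) (hXC : τ.regionPrec X C) :
        X.1 ⊆ {p | τ.Precedes A.1 {p} ∧ τ.Precedes {p} C.1} := by
      refine fun x hx => ⟨?_, ?_⟩
      · rintro a ha _ rfl
        exact hAX a ha _ hx
      · rintro _ rfl
        exact hXC _ hx
    have hpair := pairwise_of_isCausalPath hP
    cases P with
    | nil =>
      have hQ : CausalSite.IsCausalPath τ.regionSub τ.regionPrec A C [D] :=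
        ⟨by simpa using not_isEmptyRegion_iff.2 hD, by simp [hAD, hDC]⟩
      exact ⟨[D], hQ, ⟨hM.disjointSet_of_isCausalPath hP, hM.disjointSet_of_isCausalPath hQ,
        by simp⟩, D, List.mem_cons_self, hsub D hAD hDC⟩
    | cons X P =>
      have hdis := hM.disjointSet_of_isCausalPath hP
      refine ⟨X :: P, hP, ⟨hdis, hdis, fun Y hY => ⟨Y, hY, subset_rfl⟩⟩, X,
        List.mem_cons_self, hsub X ?_ ?_⟩
      · exact List.rel_of_pairwise_cons hpair (by simp)
      · exact List.rel_of_pairwise_cons (List.pairwise_cons.1 hpair).2 (by simp)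

theorem NoClosedTimelikeCurves.isCausalSite (hM : τ.NoClosedTimelikeCurves) :
    CausalSite.IsCausalSite τ.regionSub τ.regionPrec where
  sub_trans _ _ _ := Set.Subset.trans
  sub_refl _ := subset_rfl
  sub_antisymm _ _ hAB hBA := Subtype.ext (Set.Subset.antisymm hAB hBA)
  exists_empty := ⟨⟨∅, isBoundedRegion_empty⟩, isEmptyRegion_iff.2 rfl⟩
  exists_union A B := ⟨_, isUnion_union A B⟩
  prec_trans _ _ _ _ hB _ := Precedes.trans (not_isEmptyRegion_iff.1 hB)
  prec_irrefl A hA h := by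
    obtain ⟨a, ha⟩ := not_isEmptyRegion_iff.1 hA
    exact hM.not_chron_self a (h a ha a ha)
  prec_of_sub_left _ _ _ hAB hBC a ha := hBC a (hAB ha)
  prec_of_sub_right _ _ _ hAB hCB c hc a ha := hCB c hc a (hAB ha)
  union_prec A B C U hU hAC hBC u hu := by
    rcases hU.least _ (isUnion_union A B).left (isUnion_union A B).right hu with h | h
    · exact hAC u h
    · exact hBC u h
  exists_cutting A B := ⟨_, isCutting_cutting A B⟩
  exists_complete _ _ hA hC _ := by
    rintro ⟨D, hD, hAD, hDC⟩
    exact ⟨_, hM.isComplete_between (not_isEmptyRegion_iff.1 hA) (not_isEmptyRegion_iff.1 hC)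
      (not_isEmptyRegion_iff.1 hD) hAD hDC⟩

end TimeOrientation

theorem mainTheorem4 {n : ℕ} {M : Type*} [TopologicalSpace M]
    [ChartedSpace (EuclideanSpace ℝ (Fin n)) M] [IsManifold (𝓡 n) ∞ M]
    (g : LorentzianMetric n M) (τ : TimeOrientation g) (hM : τ.NoClosedTimelikeCurves) :
    CausalSite.IsCausalSite τ.regionSub τ.regionPrec ∧
    (∀ A B : τ.Region, ∃ hK : τ.IsBoundedRegion {p | p ∈ B.1 ∧ τ.Precedes {p} A.1},
      CausalSite.IsCutting τ.regionSub τ.regionPrec A B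
        ⟨{p | p ∈ B.1 ∧ τ.Precedes {p} A.1}, hK⟩) ∧
    (∀ A C : τ.Region, A.1.Nonempty → C.1.Nonempty → τ.regionPrec A C →
      (∃ D : τ.Region, D.1.Nonempty ∧ τ.regionPrec A D ∧ τ.regionPrec D C) →
      ∃ hB : τ.IsBoundedRegion {p | τ.Precedes A.1 {p} ∧ τ.Precedes {p} C.1},
        CausalSite.IsComplete τ.regionSub τ.regionPrec A C
          ⟨{p | τ.Precedes A.1 {p} ∧ τ.Precedes {p} C.1}, hB⟩) := by
  refine ⟨hM.isCausalSite,
    fun A B => ⟨TimeOrientation.isBoundedRegion_cutting A B,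
      TimeOrientation.isCutting_cutting A B⟩, ?_⟩
  rintro A C hA hC - ⟨D, hD, hAD, hDC⟩
  exact ⟨TimeOrientation.isBoundedRegion_between hA hC,
    hM.isComplete_between hA hC hD hAD hDC⟩
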